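/- Let $p_0=(p_0(1),\dots,p_0(d))$ be a probability vector and $n\ge 1$ an integer. Consider the Poissonized multinomial model under the null: $n_0\sim\mathrm{Poisson}(n)$, independent of i.i.d. observations $Z^{(1)},Z^{(2)},\dots\in\{1,\dots,d\}$ with distribution $p_0$, and counts $X_i=\#\{1\le m\le n_0: Z^{(m)}=i\}$, $i=1,\dots,d$. 1. (Classical asymptotics.) Fix $d$, any probability vector $p_0$ on $\{1,\dots,d\}$ and positive weights $w_1,\dots,w_d$ that do not depend on $n$, and let $$T(w)=\sum_{i=1}^d\frac{(X_i-np_0(i))^2-X_i}{w_i}.$$ Then, as $n\to\infty$, $$\frac{T(w)}{n}\ \overset{d}{\to}\ \sum_{i=1}^d\frac{p_0(i)}{w_i}\,(Z_i-1),$$ where $Z_1,\dots,Z_d$ are independent $\chi^2_1$ random variables. 2. (High-dimensional asymptotics.) Let $p_0$ be uniform on $\{1,\dots,d\}$, and let $$T_{\ell_2}=\sum_{i=1}^d\left[(X_i-np_0(i))^2-X_i\right].$$ Its variance $\mathrm{Var}_0(T_{\ell_2})$ under the null is finite and positive. Along any sequence of pairs $(d,n)$ of positive integers with $d\to\infty$: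 * if $n/\sqrt d\to\infty$, then $T_{\ell_2}/\sqrt{\mathrm{Var}_0(T_{\ell_2})}\overset{d}{\to}N(0,1)$; * if $n/\sqrt d\to 0$, then $T_{\ell_2}/\sqrt{\mathrm{Var}_0(T_{\ell_2})}\overset{d}{\to}\delta_0$, the point mass at $0$. -/

import Mathlib

open MeasureTheory ProbabilityTheory Filter Topology
open scoped NNReal ENNReal

namespace PoissonizedMultinomial

/-- The law of `(n₀, (Z₁, Z₂, …))`, where the sample size `n₀` is `Poisson(n)`-distributed, the
observations `Z₁, Z₂, …` are i.i.d. with distribution `p` on `d` cells, and `n₀` is independent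
of the observations. The sample consists of the first `n₀` observations. -/
noncomputable def sampleLaw {d : ℕ} (n : ℕ) (p : PMF (Fin d)) : Measure (ℕ × (ℕ → Fin d)) :=
  (poissonMeasure (n : ℝ≥0)).prod (Measure.infinitePi fun _ : ℕ => p.toMeasure)

instance {d : ℕ} (n : ℕ) (p : PMF (Fin d)) : IsProbabilityMeasure (sampleLaw n p) := by
  unfold sampleLaw
  infer_instance

/-- The number `X_j` of observations in the sample that fall in cell `j`. -/
def count {d : ℕ} (j : Fin d) (s : ℕ × (ℕ → Fin d)) : ℕ :=
  ((Finset.range s.1).filter fun i => s.2 i = j).card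

/-- The weighted statistic `T(w) = ∑_j ((X_j - n p₀(j))² - X_j) / w_j`. -/
noncomputable def weightedStat {d : ℕ} (n : ℕ) (p₀ : PMF (Fin d)) (w : Fin d → ℝ)
    (s : ℕ × (ℕ → Fin d)) : ℝ :=
  ∑ j, (((count j s : ℝ) - n * (p₀ j).toReal) ^ 2 - count j s) / w j

/-- The statistic `T_{ℓ₂} = ∑_j [(X_j - n p₀(j))² - X_j]`. -/
noncomputable def ellTwoStat {d : ℕ} (n : ℕ) (p₀ : PMF (Fin d)) (s : ℕ × (ℕ → Fin d)) : ℝ :=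
  ∑ j, (((count j s : ℝ) - n * (p₀ j).toReal) ^ 2 - count j s)

/-- `T_{ℓ₂} / √(Var₀ T_{ℓ₂})`, the variance being taken under the null `p₀`. -/
noncomputable def standardizedEllTwo {d : ℕ} (n : ℕ) (p₀ : PMF (Fin d))
    (s : ℕ × (ℕ → Fin d)) : ℝ :=
  ellTwoStat n p₀ s / √(variance (ellTwoStat n p₀) (sampleLaw n p₀))

/-- The `χ²` distribution with one degree of freedom: the law of the square of a standard
normal variable. -/
noncomputable def chiSqOne : Measure ℝ := (gaussianReal 0 1).map fun x => x ^ 2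

instance : IsProbabilityMeasure chiSqOne :=
  Measure.isProbabilityMeasure_map (by fun_prop)

end PoissonizedMultinomial

namespace PoissonizedMultinomial

/-! Poissonization makes the counts independent, `X_j ~ Poisson(n p₀(j))` (`map_count_sampleLaw`).
Both statistics are sums of functions of single counts, so their characteristic functions are
products over cells. Lévy's continuity theorem then reduces every limit to an estimate for one cell.

In the classical regime each cell obeys the Poisson CLT. Squaring by continuous mapping gives a
scaled, centred `χ²₁`, and replacing `X_j` by its mean costs `O(n^{-1/2})` in `L¹`.

In the uniform regime all cells share the rate `r = n/d`, so the characteristic function is a `d`-th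
power. A cell statistic has mean 0 and variance `2r²`, so the total standard deviation is `s = √(2d)
r = √2 n/√d`. If `s → ∞`, a second order expansion with explicit fourth moment compares the power
with `(1 - t²/(2d))^d`, with error `O(√(1/s² + 1/d))` for fixed `t`
(`norm_charFun_cellStat_pow_sub_le`). If `s → 0`, the first absolute moment of a cell is at most
`4r²`, far below its standard deviation `√2 r`. The normalized sum is then `O(s)` in `L¹` and
vanishes (`norm_charFun_cellStat_pow_sub_one_le`). -/

/-! ### Poisson factorial moments and the moments of one cell. -/

lemma hasSum_poisson_descFactorial (r : ℝ≥0) (j : ℕ) :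
    HasSum (fun k : ℕ => Real.exp (-r) * (r : ℝ) ^ k / (k.factorial : ℝ) * k.descFactorial j)
      ((r : ℝ) ^ j) := by
  have h := (hasSum_one_poissonMeasure r).mul_left ((r : ℝ) ^ j)
  rw [mul_one] at h
  -- Terms with `k < j` vanish. After the shift `k ↦ k + j` the falling factorial cancels against
  -- the factorial, leaving `r ^ j` times the Poisson weights.
  rw [← (add_left_injective j).hasSum_iff]
  · convert! h using 2 with k
    have h1 : ((k + j).factorial : ℝ) = k.factorial * (k + j).descFactorial j := by
      rw [← Nat.cast_mul, ← Nat.factorial_mul_descFactorial (Nat.le_add_left j k),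
        Nat.add_sub_cancel]
    have h2 : ((k + j).descFactorial j : ℝ) ≠ 0 := by
      simp [Nat.descFactorial_eq_zero_iff_lt]
    have h3 : (k.factorial : ℝ) ≠ 0 := by positivity
    simp only [Function.comp]
    rw [h1, pow_add]
    field_simp
  · intro k hk
    have : k < j := by
      by_contra hlt
      exact hk ⟨k - j, by simp; omega⟩
    simp [Nat.descFactorial_of_lt this]

lemma integrable_poisson_descFactorial (r : ℝ≥0) (j : ℕ) :
    Integrable (fun k : ℕ => (k.descFactorial j : ℝ)) (poissonMeasure r) := by
  rw [integrable_poissonMeasure_iff]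
  simpa using (hasSum_poisson_descFactorial r j).summable

lemma integral_poisson_descFactorial (r : ℝ≥0) (j : ℕ) :
    ∫ k : ℕ, (k.descFactorial j : ℝ) ∂(poissonMeasure r) = (r : ℝ) ^ j := by
  rw [integral_poissonMeasure]
  simpa using (hasSum_poisson_descFactorial r j).tsum_eq

/-- The Poisson distribution as a measure on `ℝ`. -/
noncomputable abbrev realPoisson (r : ℝ≥0) : Measure ℝ :=
  (poissonMeasure r).map (Nat.cast : ℕ → ℝ)

lemma cast_descFactorial_eq_prod (k j : ℕ) :
    (k.descFactorial j : ℝ) = ∏ i ∈ Finset.range j, ((k : ℝ) - i) := by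
  induction j with
  | zero => simp
  | succ j ih =>
    rw [Nat.descFactorial_succ, Nat.cast_mul, Finset.prod_range_succ, ← ih, mul_comm]
    rcases le_or_gt j k with h | h
    · rw [Nat.cast_sub h]
    · simp [Nat.descFactorial_of_lt h]

/-- Poisson moments of a polynomial written in the falling factorial basis. -/
lemma realPoisson_moment_of_newton (r : ℝ≥0) {N : ℕ} (c : Fin N → ℝ) {f : ℝ → ℝ}
    (hf : ∀ k : ℕ, f k = ∑ j, c j * ∏ i ∈ Finset.range (j : ℕ), ((k : ℝ) - i)) :
    Integrable f (realPoisson r) ∧ ∫ x, f x ∂(realPoisson r) = ∑ j, c j * (r : ℝ) ^ (j : ℕ) := by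
  simp_rw [← cast_descFactorial_eq_prod] at hf
  have hi (j : Fin N) := (integrable_poisson_descFactorial r j).const_mul (c j)
  constructor
  · rw [(MeasurableEmbedding.natCast (α := ℝ)).integrable_map_iff, show f ∘ Nat.cast = _ from funext hf]
    exact integrable_finsetSum _ fun j _ => hi j
  · rw [(MeasurableEmbedding.natCast (α := ℝ)).integral_map]
    simp_rw [hf]
    rw [integral_finsetSum _ fun j _ => hi j]
    refine Finset.sum_congr rfl fun j _ => ?_
    rw [integral_const_mul, integral_poisson_descFactorial]

/-- The summand `(x - r)² - x` of the statistic. -/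
def cellStat (r x : ℝ) : ℝ := (x - r) ^ 2 - x

@[fun_prop]
lemma continuous_cellStat (r : ℝ) : Continuous (cellStat r) := by
  unfold cellStat; fun_prop

lemma realPoisson_sub_sq (r : ℝ≥0) :
    Integrable (fun x : ℝ => (x - r) ^ 2) (realPoisson r) ∧
      ∫ x, (x - r) ^ 2 ∂(realPoisson r) = (r : ℝ) := by
  obtain ⟨h1, h2⟩ := realPoisson_moment_of_newton r (f := fun x : ℝ => (x - r) ^ 2)
    ![(r : ℝ) ^ 2, -2 * r + 1, 1] (fun k => by
      simp [Fin.sum_univ_succ, Finset.prod_range_succ]; ring)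
  refine ⟨h1, h2.trans ?_⟩
  simp [Fin.sum_univ_succ]; ring

lemma realPoisson_cellStat (r : ℝ≥0) :
    Integrable (cellStat r) (realPoisson r) ∧ ∫ x, cellStat r x ∂(realPoisson r) = 0 := by
  obtain ⟨h1, h2⟩ := realPoisson_moment_of_newton r (f := cellStat r)
    ![(r : ℝ) ^ 2, -2 * r, 1] (fun k => by
      simp [Fin.sum_univ_succ, Finset.prod_range_succ, cellStat]; ring)
  refine ⟨h1, h2.trans ?_⟩
  simp [Fin.sum_univ_succ]; ring

lemma realPoisson_cellStat_sq (r : ℝ≥0) :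
    Integrable (fun x => cellStat r x ^ 2) (realPoisson r) ∧
      ∫ x, cellStat r x ^ 2 ∂(realPoisson r) = 2 * (r : ℝ) ^ 2 := by
  obtain ⟨h1, h2⟩ := realPoisson_moment_of_newton r (f := fun x => cellStat r x ^ 2)
    ![(r : ℝ) ^ 4, -4 * r ^ 3 + 4 * r ^ 2, 6 * r ^ 2 - 8 * r + 2, -4 * r + 4, 1] (fun k => by
      simp [Fin.sum_univ_succ, Finset.prod_range_succ, cellStat]; ring)
  refine ⟨h1, h2.trans ?_⟩
  simp [Fin.sum_univ_succ]; ring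

/-- The coefficients are those of `cellStat r x ^ 4` in the falling factorial basis. Terms above `r
^ 4` cancel on integration, so for `r` bounded away from 0 this is of the order of the squared
variance. -/
lemma realPoisson_cellStat_pow_four (r : ℝ≥0) :
    Integrable (fun x => cellStat r x ^ 4) (realPoisson r) ∧
      ∫ x, cellStat r x ^ 4 ∂(realPoisson r) =
        60 * (r : ℝ) ^ 4 + 144 * (r : ℝ) ^ 3 + 8 * (r : ℝ) ^ 2 := by
  obtain ⟨h1, h2⟩ := realPoisson_moment_of_newton r (f := fun x => cellStat r x ^ 4)
    ![(r : ℝ) ^ 8, -8 * r ^ 7 + 24 * r ^ 6 + 16 * r ^ 4 - 32 * r ^ 5,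
      28 * r ^ 6 - 144 * r ^ 5 + 316 * r ^ 4 + 8 - 64 * r + 208 * r ^ 2 - 352 * r ^ 3,
      -56 * r ^ 5 + 360 * r ^ 4 - 944 * r ^ 3 + 1232 * r ^ 2 + 208 - 800 * r,
      70 * r ^ 4 - 480 * r ^ 3 + 1256 * r ^ 2 - 1472 * r + 652,
      -56 * r ^ 3 + 360 * r ^ 2 - 784 * r + 576, 28 * r ^ 2 - 144 * r + 188,
      -8 * r + 24, 1] (fun k => by
      simp [Fin.sum_univ_succ, Finset.prod_range_succ, cellStat]; ring)
  refine ⟨h1, h2.trans ?_⟩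
  simp [Fin.sum_univ_succ]; ring

lemma memLp_two_cellStat (r : ℝ≥0) : MemLp (cellStat r) 2 (realPoisson r) :=
  (memLp_two_iff_integrable_sq (continuous_cellStat _).aestronglyMeasurable).2
    (realPoisson_cellStat_sq r).1

lemma variance_cellStat (r : ℝ≥0) : variance (cellStat r) (realPoisson r) = 2 * (r : ℝ) ^ 2 := by
  rw [variance_of_integral_eq_zero (continuous_cellStat _).aemeasurable (realPoisson_cellStat r).2,
    (realPoisson_cellStat_sq r).2]

/-- Apply the triangle inequality to `x(x - 1) - 2rx + r²`, whose three parts have absolute means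
`r²`, `2r²`, `r²`. For small `r` this beats the Cauchy–Schwarz bound `√2 r`, which is what the
degenerate limit needs. -/
lemma integral_abs_cellStat_le (r : ℝ≥0) :
    ∫ x, |cellStat r x| ∂(realPoisson r) ≤ 4 * (r : ℝ) ^ 2 := by
  obtain ⟨h1, h2⟩ := realPoisson_moment_of_newton r (f := fun x => x * (x - 1) + 2 * r * x + r ^ 2)
    ![(r : ℝ) ^ 2, 2 * r, 1] (fun k => by
      simp [Fin.sum_univ_succ, Finset.prod_range_succ]; ring)
  calc ∫ x, |cellStat r x| ∂(realPoisson r)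
      ≤ ∫ x, (x * (x - 1) + 2 * r * x + r ^ 2) ∂(realPoisson r) := by
        refine integral_mono_ae (realPoisson_cellStat r).1.abs h1 ?_
        refine (MeasurableEmbedding.natCast (α := ℝ)).ae_map_iff.2 (Eventually.of_forall fun k => ?_)
        -- True at natural numbers but not on all of `ℝ`, so the comparison is only almost
        -- everywhere.
        have hk : (0 : ℝ) ≤ k * (k - 1) := by
          rcases k with _ | k
          · simp
          · push_cast; rw [add_sub_cancel_right]; positivity
        have hr : (0 : ℝ) ≤ r * k := by positivity
        simp only [cellStat, abs_le]
        constructor <;> nlinarith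
    _ = _ := by
        rw [h2]; simp [Fin.sum_univ_succ]; ring

/-! ### Independence of the Poissonized counts. -/

/-- The probability generating function of the Poisson distribution. -/
lemma integral_pow_poissonMeasure (r : ℝ≥0) (z : ℂ) :
    ∫ m : ℕ, z ^ m ∂(poissonMeasure r) = Complex.exp (r * (z - 1)) := by
  rw [integral_poissonMeasure]
  calc ∑' m : ℕ, (Real.exp (-r) * (r : ℝ) ^ m / (m.factorial : ℝ)) • z ^ m
      = ∑' m : ℕ, (Real.exp (-r) : ℂ) * ((r * z) ^ m / (m.factorial : ℂ)) := by
        congr with m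
        rw [Complex.real_smul]
        push_cast
        rw [mul_pow]
        ring
    _ = (Real.exp (-r) : ℂ) * ∑' m : ℕ, ((r * z) ^ m / (m.factorial : ℂ)) := tsum_mul_left
    _ = (Real.exp (-r) : ℂ) * Complex.exp (r * z) := by
        rw [(NormedSpace.expSeries_div_hasSum_exp ((r : ℂ) * z)).tsum_eq, Complex.exp_eq_exp_ℂ]
    _ = Complex.exp (r * (z - 1)) := by
        rw [Complex.ofReal_exp, ← Complex.exp_add]
        push_cast
        ring_nf

lemma measurable_count {d : ℕ} (j : Fin d) : Measurable (count j) := by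
  refine measurable_from_prod_countable_right fun m => ?_
  have : (fun z : ℕ → Fin d => count j (m, z)) =
      fun z => ∑ i ∈ Finset.range m, if z i = j then 1 else 0 := by
    funext z
    exact Finset.card_filter _ _
  rw [this]
  refine Finset.measurable_sum _ fun i _ => ?_
  exact (Measurable.of_discrete (f := fun a : Fin d => if a = j then 1 else 0)).comp
    (measurable_pi_apply i)

lemma measurable_count_vector {d : ℕ} :
    Measurable fun (s : ℕ × (ℕ → Fin d)) (j : Fin d) => (count j s : ℝ) :=
  measurable_pi_lambda _ fun j => (Measurable.of_discrete (f := (Nat.cast : ℕ → ℝ))).comp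
    (measurable_count j)

lemma sum_mul_count {d : ℕ} (t : Fin d → ℝ) (s : ℕ × (ℕ → Fin d)) :
    ∑ j, (count j s : ℝ) * t j = ∑ i ∈ Finset.range s.1, t (s.2 i) := by
  simp_rw [count, Finset.card_filter, Nat.cast_sum, Finset.sum_mul]
  rw [Finset.sum_comm]
  refine Finset.sum_congr rfl fun i _ => ?_
  simp

lemma integral_exp_sum_infinitePi {d : ℕ} (p : PMF (Fin d)) (t : Fin d → ℝ) (m : ℕ) :
    ∫ z : ℕ → Fin d, Complex.exp ((∑ i ∈ Finset.range m, t (z i) : ℝ) * Complex.I)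
      ∂(Measure.infinitePi fun _ : ℕ => p.toMeasure) =
    (∑ j, (p j).toReal * Complex.exp (t j * Complex.I)) ^ m := by
  have ht : Measurable t := .of_discrete
  have hind : iIndepFun (fun (i : ℕ) (z : ℕ → Fin d) => t (z i))
      (Measure.infinitePi fun _ : ℕ => p.toMeasure) :=
    iIndepFun_infinitePi (X := fun _ => t) fun _ => ht
  have hmap (i : ℕ) : (Measure.infinitePi fun _ : ℕ => p.toMeasure).map
      (fun z : ℕ → Fin d => t (z i)) = p.toMeasure.map t := by
    conv_rhs => rw [← Measure.infinitePi_map_eval (fun _ : ℕ => p.toMeasure) i,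
      Measure.map_map ht (measurable_pi_apply i)]
    rfl
  have hmeas (i : ℕ) : Measurable fun z : ℕ → Fin d => t (z i) := ht.comp (measurable_pi_apply i)
  have h := congrFun ((hind.restrict (Finset.range m)).charFun_map_fun_finsetSum_eq_prod
    (fun i _ => (hmeas i).aemeasurable)) 1
  rw [charFun_apply_real,
    integral_map (Finset.measurable_sum _ fun i _ => hmeas i).aemeasurable (by fun_prop)] at h
  simp only [Complex.ofReal_one, one_mul] at h
  rw [h, Finset.prod_apply]
  simp_rw [hmap]
  rw [Finset.prod_const, Finset.card_range, charFun_apply_real,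
    integral_map (by fun_prop) (by fun_prop), PMF.integral_eq_sum]
  simp

/-- The Poisson rate of the `j`-th cell. -/
noncomputable def cellRate {d : ℕ} (n : ℕ) (p : PMF (Fin d)) (j : Fin d) : ℝ≥0 :=
  n * (p j).toNNReal

@[simp]
lemma coe_cellRate {d : ℕ} (n : ℕ) (p : PMF (Fin d)) (j : Fin d) :
    (cellRate n p j : ℝ) = n * (p j).toReal := rfl

lemma sum_toReal_eq_one {d : ℕ} (p : PMF (Fin d)) : ∑ j, (p j).toReal = 1 := by
  rw [← ENNReal.toReal_sum fun j _ => p.apply_ne_top j, ← tsum_fintype (L := .unconditional _),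
    p.tsum_coe, ENNReal.toReal_one]

/-- The counts of a Poissonized multinomial sample are independent Poisson variables. -/
lemma map_count_sampleLaw {d : ℕ} (n : ℕ) (p : PMF (Fin d)) :
    (sampleLaw n p).map (fun s j => (count j s : ℝ)) =
      Measure.pi fun j => realPoisson (cellRate n p j) := by
  have hm := measurable_count_vector (d := d)
  have : IsProbabilityMeasure ((sampleLaw n p).map (fun s j => (count j s : ℝ))) :=
    Measure.isProbabilityMeasure_map hm.aemeasurable
  rw [← charFun_eq_pi_iff]
  intro t
  have h1 (s : ℕ × (ℕ → Fin d)) :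
      inner ℝ (WithLp.toLp 2 fun j => (count j s : ℝ)) t =
        ∑ i ∈ Finset.range s.1, t (s.2 i) := by
    rw [← sum_mul_count, PiLp.inner_apply]
    simp [mul_comm]
  rw [charFun_apply, integral_map (by fun_prop) (by fun_prop),
    integral_map hm.aemeasurable (by fun_prop)]
  simp_rw [h1]
  rw [sampleLaw, integral_prod]
  · simp_rw [integral_exp_sum_infinitePi, integral_pow_poissonMeasure,
      charFun_map_cast_poissonMeasure]
    rw [← Complex.exp_sum]
    congr 1
    -- Conditioning on the sample size and averaging gives `exp (n (∑ p_j e^{i t_j} - 1))`. Writing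
    -- 1 as the total mass splits the exponent into one Poisson exponent per cell.
    have h2 : (1 : ℂ) = ∑ j, ((p j).toReal : ℂ) := by
      rw [← Complex.ofReal_sum, sum_toReal_eq_one, Complex.ofReal_one]
    conv_lhs => rw [h2]
    rw [← Finset.sum_sub_distrib, Finset.mul_sum]
    refine Finset.sum_congr rfl fun j _ => ?_
    have h3 : ((cellRate n p j : ℝ≥0) : ℂ) = n * (p j).toReal := by
      rw [← Complex.ofReal_natCast, ← Complex.ofReal_mul, ← coe_cellRate]
    rw [h3]
    simp only [NNReal.coe_natCast, Complex.ofReal_natCast]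
    ring
  · refine Integrable.of_bound (C := 1) ?_ (Eventually.of_forall fun s => ?_)
    · have h4 : (fun s : ℕ × (ℕ → Fin d) => ∑ i ∈ Finset.range s.1, t (s.2 i)) =
          fun s => ∑ j, (count j s : ℝ) * t j := funext fun s => (sum_mul_count _ s).symm
      have h5 : Measurable fun s : ℕ × (ℕ → Fin d) => ∑ i ∈ Finset.range s.1, t (s.2 i) := by
        rw [h4]
        exact Finset.measurable_sum _ fun j _ => ((measurable_pi_apply j).comp hm).mul_const _
      exact (by fun_prop : Measurable fun x : ℝ => Complex.exp (x * Complex.I)).comp h5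
        |>.aestronglyMeasurable
    · rw [Complex.norm_exp_ofReal_mul_I]

/-! ### Characteristic functions of sums over cells. -/

lemma charFun_map_sum_comp_pi {d : ℕ} (μ : Fin d → Measure ℝ) [∀ j, IsProbabilityMeasure (μ j)]
    {h : Fin d → ℝ → ℝ} (hh : ∀ j, Measurable (h j)) (t : ℝ) :
    charFun ((Measure.pi μ).map fun x => ∑ j, h j (x j)) t = ∏ j, charFun ((μ j).map (h j)) t := by
  have (j : Fin d) : IsProbabilityMeasure ((μ j).map (h j)) :=
    Measure.isProbabilityMeasure_map (hh j).aemeasurable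
  rw [← Finset.prod_apply, ← charFun_map_sum_pi_eq_prod,
    ← Measure.pi_map_pi fun j => (hh j).aemeasurable, Measure.map_map (by fun_prop) (by fun_prop)]
  rfl

lemma measurable_sum_comp_count {d : ℕ} {h : Fin d → ℝ → ℝ} (hh : ∀ j, Measurable (h j)) :
    Measurable fun s : ℕ × (ℕ → Fin d) => ∑ j, h j (count j s) :=
  Finset.measurable_sum _ fun j _ => (hh j).comp <|
    (Measurable.of_discrete (f := (Nat.cast : ℕ → ℝ))).comp (measurable_count j)

lemma map_sum_comp_count {d : ℕ} (n : ℕ) (p : PMF (Fin d)) {h : Fin d → ℝ → ℝ}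
    (hh : ∀ j, Measurable (h j)) :
    (sampleLaw n p).map (fun s => ∑ j, h j (count j s)) =
      (Measure.pi fun j => realPoisson (cellRate n p j)).map fun x => ∑ j, h j (x j) := by
  have hm := measurable_count_vector (d := d)
  rw [← map_count_sampleLaw, Measure.map_map (by fun_prop) hm]
  rfl

/-- The characteristic function of a sum of functions of the individual counts. -/
lemma charFun_map_sum_comp_count {d : ℕ} (n : ℕ) (p : PMF (Fin d)) {h : Fin d → ℝ → ℝ}
    (hh : ∀ j, Measurable (h j)) (t : ℝ) :
    charFun ((sampleLaw n p).map fun s => ∑ j, h j (count j s)) t =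
      ∏ j, charFun ((realPoisson (cellRate n p j)).map (h j)) t := by
  rw [map_sum_comp_count n p hh, charFun_map_sum_comp_pi _ hh]

/-! ### Estimates for characteristic functions. -/

/-- Taylor's remainder for `|x| ≤ 1`, the triangle inequality beyond. Validity for every `x` makes
truncation unnecessary later; the constant 4 is not sharp. -/
lemma norm_exp_mul_I_sub_le (x : ℝ) :
    ‖Complex.exp (x * Complex.I) - (1 + x * Complex.I - x ^ 2 / 2)‖ ≤ 4 * |x| ^ 3 := by
  rcases le_or_gt |x| 1 with h | h
  · have hx : ‖(x : ℂ) * Complex.I‖ = |x| := by simp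
    have := Complex.exp_bound (x := x * Complex.I) (by rw [hx]; exact h) (n := 3) (by norm_num)
    rw [hx] at this
    calc _ = ‖Complex.exp (x * Complex.I) -
          ∑ m ∈ Finset.range 3, (x * Complex.I) ^ m / (m.factorial : ℂ)‖ := by
          congr 2
          simp [Finset.sum_range_succ, mul_pow, Nat.factorial]
          ring
      _ ≤ _ := this
      _ ≤ 4 * |x| ^ 3 := by
          rw [mul_comm]
          gcongr
          norm_num [Nat.factorial]
  · calc _ ≤ ‖Complex.exp (x * Complex.I)‖ + (‖(1 : ℂ)‖ + ‖(x : ℂ) * Complex.I‖ +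
          ‖(x : ℂ) ^ 2 / 2‖) :=
          (norm_sub_le _ _).trans (add_le_add_right ((norm_sub_le _ _).trans
            (add_le_add_left (norm_add_le _ _) _)) _)
      _ = 1 + (1 + |x| + |x| ^ 2 / 2) := by
          rw [Complex.norm_exp_ofReal_mul_I]; simp
      _ ≤ 4 * |x| ^ 3 := by nlinarith [mul_pos (sub_pos.2 h) (sub_pos.2 h), pow_pos (sub_pos.2 h) 3]

lemma norm_exp_mul_I_sub_exp_mul_I_le (x y : ℝ) :
    ‖Complex.exp (x * Complex.I) - Complex.exp (y * Complex.I)‖ ≤ |x - y| := by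
  have h : Complex.exp (x * Complex.I) - Complex.exp (y * Complex.I) =
      Complex.exp (y * Complex.I) * (Complex.exp (Complex.I * (x - y : ℝ)) - 1) := by
    rw [mul_sub, ← Complex.exp_add, mul_one]
    push_cast
    ring_nf
  rw [h, norm_mul, Complex.norm_exp_ofReal_mul_I, one_mul]
  exact Real.norm_exp_I_mul_ofReal_sub_one_le

lemma charFun_map_real {Ω : Type*} {mΩ : MeasurableSpace Ω} {μ : Measure Ω} {f : Ω → ℝ}
    (hf : AEMeasurable f μ) (t : ℝ) :
    charFun (μ.map f) t = ∫ ω, Complex.exp ((t * f ω : ℝ) * Complex.I) ∂μ := by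
  rw [charFun_apply_real, integral_map hf (by fun_prop)]
  push_cast
  rfl

lemma integrable_exp_mul_I {Ω : Type*} {mΩ : MeasurableSpace Ω} {μ : Measure Ω}
    [IsProbabilityMeasure μ] {f : Ω → ℝ} (hf : AEMeasurable f μ) :
    Integrable (fun ω => Complex.exp (f ω * Complex.I)) μ := by
  refine Integrable.of_bound (C := 1) ?_ (Eventually.of_forall fun s => ?_)
  · exact ((by fun_prop : Measurable fun x : ℝ => Complex.exp (x * Complex.I)).comp_aemeasurable
      hf).aestronglyMeasurable
  · rw [Complex.norm_exp_ofReal_mul_I]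

/-- Characteristic functions are Lipschitz with respect to the `L¹` distance. -/
lemma norm_charFun_map_sub_le {Ω : Type*} {mΩ : MeasurableSpace Ω} {μ : Measure Ω}
    [IsProbabilityMeasure μ] {f g : Ω → ℝ} (hf : AEMeasurable f μ) (hg : AEMeasurable g μ)
    (hfg : Integrable (fun ω => f ω - g ω) μ) (t : ℝ) :
    ‖charFun (μ.map f) t - charFun (μ.map g) t‖ ≤ |t| * ∫ ω, |f ω - g ω| ∂μ := by
  rw [charFun_map_real hf, charFun_map_real hg,
    ← integral_sub (integrable_exp_mul_I (hf.const_mul t)) (integrable_exp_mul_I (hg.const_mul t)),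
    ← integral_const_mul]
  refine norm_integral_le_of_norm_le (hfg.abs.const_mul _) (Eventually.of_forall fun ω => ?_)
  rw [← abs_mul, mul_sub]
  exact norm_exp_mul_I_sub_exp_mul_I_le _ _

/-- Second order expansion of the characteristic function of a centred variable, with the third
absolute moment bounded through the second and fourth moments. -/
lemma norm_charFun_map_sub_one_add_le {Ω : Type*} {mΩ : MeasurableSpace Ω} {μ : Measure Ω}
    [IsProbabilityMeasure μ] {f : Ω → ℝ} (hf : Integrable f μ) (h0 : ∫ ω, f ω ∂μ = 0)
    (h2 : Integrable (fun ω => f ω ^ 2) μ) (h4 : Integrable (fun ω => f ω ^ 4) μ)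
    {a : ℝ} (ha : 0 < a) (t : ℝ) :
    ‖charFun (μ.map f) t - (1 - t ^ 2 / 2 * ∫ ω, f ω ^ 2 ∂μ : ℝ)‖ ≤
      2 * |t| ^ 3 * (a * ∫ ω, f ω ^ 2 ∂μ + a⁻¹ * ∫ ω, f ω ^ 4 ∂μ) := by
  have e1 : Integrable (fun ω => ((t * f ω : ℝ) : ℂ) * Complex.I) μ :=
    ((hf.const_mul t).ofReal).mul_const _
  have e12 : Integrable (fun ω => 1 + ((t * f ω : ℝ) : ℂ) * Complex.I) μ :=
    (integrable_const _).add e1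
  have e2 : Integrable (fun ω => ((t * f ω : ℝ) : ℂ) ^ 2 / 2) μ := by
    have e : Integrable (fun ω => ((t ^ 2 / 2 * f ω ^ 2 : ℝ) : ℂ)) μ :=
      (h2.const_mul (t ^ 2 / 2)).ofReal
    refine e.congr (Eventually.of_forall fun ω => ?_)
    push_cast
    ring
  have hmain : ((1 - t ^ 2 / 2 * ∫ ω, f ω ^ 2 ∂μ : ℝ) : ℂ) =
      ∫ ω, (1 + (t * f ω : ℝ) * Complex.I - (t * f ω : ℝ) ^ 2 / 2 : ℂ) ∂μ := by
    rw [integral_sub e12 e2, integral_add (integrable_const _) e1,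
      integral_mul_const, integral_complex_ofReal, integral_const_mul, h0]
    have e3 : ∫ ω, ((t * f ω : ℝ) : ℂ) ^ 2 / 2 ∂μ = ((t ^ 2 / 2 * ∫ ω, f ω ^ 2 ∂μ : ℝ) : ℂ) := by
      rw [← integral_const_mul, ← integral_complex_ofReal]
      congr with ω
      push_cast
      ring
    rw [e3]
    simp
  have hint : Integrable (fun ω => a * f ω ^ 2 + a⁻¹ * f ω ^ 4) μ :=
    (h2.const_mul a).add (h4.const_mul a⁻¹)
  rw [charFun_map_real hf.aemeasurable, hmain, ← integral_sub
    (integrable_exp_mul_I (hf.aemeasurable.const_mul t)), ← integral_const_mul a,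
    ← integral_const_mul a⁻¹, ← integral_add (h2.const_mul a) (h4.const_mul a⁻¹),
    ← integral_const_mul]
  · refine norm_integral_le_of_norm_le (hint.const_mul _) (Eventually.of_forall fun ω => ?_)
    refine (norm_exp_mul_I_sub_le _).trans ?_
    rw [abs_mul, mul_pow]
    -- AM–GM: the absolute cube is not a polynomial, so it is traded for even powers, with `a` left
    -- free to balance them.
    have key : 2 * |f ω| ^ 3 ≤ a * f ω ^ 2 + a⁻¹ * f ω ^ 4 := by
      have h : 0 ≤ a⁻¹ * |f ω| ^ 2 * (a - |f ω|) ^ 2 := by positivity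
      have e : a⁻¹ * |f ω| ^ 2 * (a - |f ω|) ^ 2 =
          a * |f ω| ^ 2 + a⁻¹ * (|f ω| ^ 2) ^ 2 - 2 * |f ω| ^ 3 := by
        field_simp
        ring
      rw [e, sq_abs] at h
      linarith
    have ht : 0 ≤ |t| ^ 3 := by positivity
    nlinarith [mul_le_mul_of_nonneg_left key ht]
  · exact e12.sub e2

/-- Telescoping: factors are exchanged one at a time, the others having norm at most 1. -/
lemma norm_pow_sub_pow_le_of_norm_le_one {z w : ℂ} (hz : ‖z‖ ≤ 1) (hw : ‖w‖ ≤ 1) (m : ℕ) :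
    ‖z ^ m - w ^ m‖ ≤ m * ‖z - w‖ := by
  induction m with
  | zero => simp
  | succ m ih =>
    have : z ^ (m + 1) - w ^ (m + 1) = z ^ m * (z - w) + (z ^ m - w ^ m) * w := by ring
    rw [this]
    refine (norm_add_le _ _).trans ?_
    rw [norm_mul, norm_mul, norm_pow]
    have h1 : ‖z‖ ^ m * ‖z - w‖ ≤ 1 * ‖z - w‖ := by
      gcongr
      exact pow_le_one₀ (norm_nonneg _) hz
    have h2 : ‖z ^ m - w ^ m‖ * ‖w‖ ≤ (m * ‖z - w‖) * 1 := by gcongr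
    push_cast
    linarith

/-- Convergence in distribution of real variables from pointwise convergence of characteristic
functions. -/
lemma tendstoInDistribution_of_charFun {Ω : ℕ → Type*} {m : ∀ k, MeasurableSpace (Ω k)}
    {Ω' : Type*} {m' : MeasurableSpace Ω'} {μ : ∀ k, Measure (Ω k)}
    [∀ k, IsProbabilityMeasure (μ k)] {μ' : Measure Ω'} [IsProbabilityMeasure μ']
    {X : ∀ k, Ω k → ℝ} {Z : Ω' → ℝ} (hX : ∀ k, AEMeasurable (X k) (μ k)) (hZ : AEMeasurable Z μ')
    (h : ∀ t, Tendsto (fun k => charFun ((μ k).map (X k)) t) atTop (𝓝 (charFun (μ'.map Z) t))) :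
    TendstoInDistribution X atTop Z μ μ' where
  forall_aemeasurable := hX
  aemeasurable_limit := hZ
  tendsto := ProbabilityMeasure.tendsto_iff_tendsto_charFun.2 h

lemma tendsto_charFun_of_tendstoInDistribution {Ω : ℕ → Type*} {m : ∀ k, MeasurableSpace (Ω k)}
    {Ω' : Type*} {m' : MeasurableSpace Ω'} {μ : ∀ k, Measure (Ω k)}
    [∀ k, IsProbabilityMeasure (μ k)] {μ' : Measure Ω'} [IsProbabilityMeasure μ']
    {X : ∀ k, Ω k → ℝ} {Z : Ω' → ℝ} (h : TendstoInDistribution X atTop Z μ μ') (t : ℝ) :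
    Tendsto (fun k => charFun ((μ k).map (X k)) t) atTop (𝓝 (charFun (μ'.map Z) t)) :=
  ProbabilityMeasure.tendsto_iff_tendsto_charFun.1 h.tendsto t

/-! ### Variance of the unweighted statistic and the uniform null. -/

lemma ellTwoStat_eq_sum_cellStat {d : ℕ} (n : ℕ) (p : PMF (Fin d)) :
    ellTwoStat n p = fun s => ∑ j, cellStat (cellRate n p j) (count j s) := rfl

lemma memLp_sum_cellStat {d : ℕ} (r : Fin d → ℝ≥0) :
    MemLp (fun x : Fin d → ℝ => ∑ j, cellStat (r j) (x j)) 2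
      (Measure.pi fun j => realPoisson (r j)) :=
  memLp_finsetSum _ fun j _ => (memLp_two_cellStat (r j)).comp_measurePreserving
    (measurePreserving_eval (fun j => realPoisson (r j)) j)

lemma memLp_ellTwoStat {d : ℕ} (n : ℕ) (p : PMF (Fin d)) :
    MemLp (ellTwoStat n p) 2 (sampleLaw n p) := by
  have h := memLp_sum_cellStat (cellRate n p)
  rw [← map_count_sampleLaw] at h
  exact h.comp_of_map measurable_count_vector.aemeasurable

lemma variance_ellTwoStat {d : ℕ} (n : ℕ) (p : PMF (Fin d)) :
    variance (ellTwoStat n p) (sampleLaw n p) = ∑ j, 2 * (cellRate n p j : ℝ) ^ 2 := by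
  have h := variance_sum_pi (μ := fun j => realPoisson (cellRate n p j))
    (X := fun j => cellStat (cellRate n p j)) fun j => memLp_two_cellStat _
  simp_rw [variance_cellStat] at h
  rw [← h, ← map_count_sampleLaw, variance_map _ measurable_count_vector.aemeasurable]
  · congr 1
    funext s
    simp [ellTwoStat_eq_sum_cellStat]
  · exact (by fun_prop : Measurable (∑ j, fun x : Fin d → ℝ =>
      cellStat (cellRate n p j) (x j))).aemeasurable

lemma cellRate_uniform {d : ℕ} [NeZero d] (n : ℕ) (j : Fin d) :
    cellRate n (PMF.uniformOfFintype (Fin d)) j = n / d := by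
  simp [cellRate, div_eq_mul_inv]

/-- The standard deviation of the unweighted statistic under the uniform null. -/
noncomputable def uniformSd (d n : ℕ) : ℝ := √(2 * d * ((n / d : ℝ≥0) : ℝ) ^ 2)

lemma variance_ellTwoStat_uniform {d : ℕ} [NeZero d] (n : ℕ) :
    variance (ellTwoStat n (PMF.uniformOfFintype (Fin d)))
      (sampleLaw n (PMF.uniformOfFintype (Fin d))) = 2 * d * ((n / d : ℝ≥0) : ℝ) ^ 2 := by
  rw [variance_ellTwoStat]
  simp_rw [cellRate_uniform]
  rw [Finset.sum_const, Finset.card_univ, Fintype.card_fin, nsmul_eq_mul]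
  ring

lemma standardizedEllTwo_uniform {d : ℕ} [NeZero d] (n : ℕ) :
    standardizedEllTwo n (PMF.uniformOfFintype (Fin d)) =
      fun s => ∑ j, (uniformSd d n)⁻¹ * cellStat (n / d : ℝ≥0) (count j s) := by
  funext s
  rw [standardizedEllTwo, variance_ellTwoStat_uniform, ellTwoStat_eq_sum_cellStat, uniformSd,
    ← Finset.mul_sum, div_eq_inv_mul]
  simp_rw [cellRate_uniform]

lemma charFun_standardizedEllTwo_uniform {d : ℕ} [NeZero d] (n : ℕ) (t : ℝ) :
    charFun ((sampleLaw n (PMF.uniformOfFintype (Fin d))).map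
      (standardizedEllTwo n (PMF.uniformOfFintype (Fin d)))) t =
    charFun ((realPoisson (n / d)).map (cellStat (n / d : ℝ≥0))) ((uniformSd d n)⁻¹ * t) ^ d := by
  rw [standardizedEllTwo_uniform, charFun_map_sum_comp_count
    (h := fun _ x => (uniformSd d n)⁻¹ * cellStat (n / d : ℝ≥0) x) _ _ (fun _ => by fun_prop)]
  simp_rw [cellRate_uniform]
  rw [Finset.prod_const, Finset.card_univ, Fintype.card_fin,
    charFun_map_mul_comp (continuous_cellStat _).aemeasurable]

lemma measurable_standardizedEllTwo_uniform {d : ℕ} [NeZero d] (n : ℕ) :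
    Measurable (standardizedEllTwo n (PMF.uniformOfFintype (Fin d))) := by
  rw [standardizedEllTwo_uniform]
  exact measurable_sum_comp_count
    (h := fun _ x => (uniformSd d n)⁻¹ * cellStat (n / d : ℝ≥0) x) (fun _ => by fun_prop)

lemma isProbabilityMeasure_map_cellStat (r : ℝ≥0) :
    IsProbabilityMeasure ((realPoisson r).map (cellStat r)) :=
  Measure.isProbabilityMeasure_map (continuous_cellStat _).aemeasurable

/-! ### High-dimensional limits. -/

/-- Distance of the `d`-th power of the rescaled characteristic function of one cell to the `d`-th
power of its Gaussian approximation. -/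
lemma norm_charFun_cellStat_pow_sub_le (r : ℝ≥0) (hr : 0 < r) {d : ℕ} (hd : 0 < d) {t s : ℝ}
    (hs : 0 < s) (hs2 : s ^ 2 = 2 * d * (r : ℝ) ^ 2) (ht : t ^ 2 / 2 / d ≤ 2) :
    ‖charFun ((realPoisson r).map (cellStat r)) (s⁻¹ * t) ^ d -
      ((1 - t ^ 2 / 2 / d : ℝ) : ℂ) ^ d‖ ≤ 134 * |t| ^ 3 * √((s ^ 2)⁻¹ + (2 * d : ℝ)⁻¹) := by
  have := isProbabilityMeasure_map_cellStat r
  have hr' : (0 : ℝ) < r := hr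
  have hd' : (0 : ℝ) < d := Nat.cast_pos.2 hd
  -- The hypothesis `ht` is exactly what keeps the approximant above `-1`.
  have hw : ‖((1 - t ^ 2 / 2 / d : ℝ) : ℂ)‖ ≤ 1 := by
    rw [Complex.norm_real, Real.norm_eq_abs, abs_le]
    have : 0 ≤ t ^ 2 / 2 / d := by positivity
    constructor <;> linarith
  refine (norm_pow_sub_pow_le_of_norm_le_one (norm_charFun_le_one _) hw d).trans ?_
  -- The fourth moment is at most `132 r² (1 + r²)`, so this `a` makes both error terms multiples of
  -- `r² a`, with `134 = 2 + 132`. Also `(a/s)² = 1/s² + 1/(2d)`, which covers small and large rates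
  -- together.
  set a : ℝ := √(1 + (r : ℝ) ^ 2) with ha_def
  have ha : 0 < a := by positivity
  have ha2 : a ^ 2 = 1 + (r : ℝ) ^ 2 := Real.sq_sqrt (by positivity)
  have h := norm_charFun_map_sub_one_add_le (realPoisson_cellStat r).1 (realPoisson_cellStat r).2
    (realPoisson_cellStat_sq r).1 (realPoisson_cellStat_pow_four r).1 ha (s⁻¹ * t)
  rw [(realPoisson_cellStat_sq r).2, (realPoisson_cellStat_pow_four r).2] at h
  have e1 : 1 - (s⁻¹ * t) ^ 2 / 2 * (2 * (r : ℝ) ^ 2) = 1 - t ^ 2 / 2 / d := by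
    have : (s⁻¹ * t) ^ 2 = t ^ 2 / (2 * d * (r : ℝ) ^ 2) := by
      rw [mul_pow, inv_pow, hs2]; ring
    rw [this]
    field_simp
  rw [e1] at h
  have h4 : 60 * (r : ℝ) ^ 4 + 144 * (r : ℝ) ^ 3 + 8 * (r : ℝ) ^ 2 ≤
      132 * (r : ℝ) ^ 2 * a ^ 2 := by
    rw [ha2]
    nlinarith [mul_nonneg (sq_nonneg (r : ℝ)) (sq_nonneg ((r : ℝ) - 1)), sq_nonneg (r : ℝ)]
  have e2 : √((s ^ 2)⁻¹ + (2 * d : ℝ)⁻¹) = a / s := by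
    rw [show (s ^ 2)⁻¹ + (2 * d : ℝ)⁻¹ = (a / s) ^ 2 by
      rw [div_pow, ha2, hs2]; field_simp]
    exact Real.sqrt_sq (by positivity)
  calc (d : ℝ) * ‖charFun ((realPoisson r).map (cellStat r)) (s⁻¹ * t) -
        ((1 - t ^ 2 / 2 / d : ℝ) : ℂ)‖
      ≤ d * (2 * |s⁻¹ * t| ^ 3 *
          (a * (2 * (r : ℝ) ^ 2) + a⁻¹ * (132 * (r : ℝ) ^ 2 * a ^ 2))) := by
        refine mul_le_mul_of_nonneg_left (h.trans ?_) hd'.le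
        gcongr
    _ = 134 * |t| ^ 3 * ((2 * d * (r : ℝ) ^ 2) * a / s ^ 3) := by
        rw [abs_mul, abs_of_pos (inv_pos.2 hs)]
        field_simp
        ring
    _ = 134 * |t| ^ 3 * √((s ^ 2)⁻¹ + (2 * d : ℝ)⁻¹) := by
        rw [e2, ← hs2]
        field_simp

/-- The `L¹` Lipschitz bound against the constant 0 costs `4r²|t|/s` per cell, and `d` cells give
`2|t| · (2dr²)/s = 2|t|s`. -/
lemma norm_charFun_cellStat_pow_sub_one_le (r : ℝ≥0) {d : ℕ} {t s : ℝ}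
    (hs : 0 < s) (hs2 : s ^ 2 = 2 * d * (r : ℝ) ^ 2) :
    ‖charFun ((realPoisson r).map (cellStat r)) (s⁻¹ * t) ^ d - 1‖ ≤ 2 * |t| * s := by
  have := isProbabilityMeasure_map_cellStat r
  have h1 := norm_pow_sub_pow_le_of_norm_le_one (z := charFun ((realPoisson r).map (cellStat r))
    (s⁻¹ * t)) (w := 1) (norm_charFun_le_one _) (by simp) d
  rw [one_pow] at h1
  have h2 := norm_charFun_map_sub_le (μ := realPoisson r) (f := cellStat r) (g := fun _ => 0)
    (continuous_cellStat _).aemeasurable aemeasurable_const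
    (by simpa using (realPoisson_cellStat r).1) (s⁻¹ * t)
  have e0 : charFun ((realPoisson r).map fun _ => (0 : ℝ)) (s⁻¹ * t) = 1 := by
    rw [charFun_map_real aemeasurable_const]; simp
  simp only [e0, sub_zero] at h2
  calc _ ≤ (d : ℝ) * (|s⁻¹ * t| * (4 * (r : ℝ) ^ 2)) := by
        refine h1.trans (mul_le_mul_of_nonneg_left (h2.trans ?_) (Nat.cast_nonneg d))
        exact mul_le_mul_of_nonneg_left (integral_abs_cellStat_le r) (abs_nonneg _)
    _ = 2 * |t| * ((2 * d * (r : ℝ) ^ 2) / s) := by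
        rw [abs_mul, abs_of_pos (inv_pos.2 hs)]
        field_simp
        ring
    _ = 2 * |t| * s := by
        rw [← hs2]
        field_simp

lemma uniformSd_eq {d : ℕ} [NeZero d] (n : ℕ) : uniformSd d n = √2 * (n / √d) := by
  have hd : (0 : ℝ) < d := Nat.cast_pos.2 (NeZero.pos d)
  rw [uniformSd, ← Real.sqrt_sq (show (0 : ℝ) ≤ √2 * (n / √d) by positivity)]
  congr 1
  rw [mul_pow, div_pow, Real.sq_sqrt (by positivity), Real.sq_sqrt hd.le]
  push_cast
  field_simp

lemma uniformSd_sq {d : ℕ} (n : ℕ) :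
    uniformSd d n ^ 2 = 2 * d * ((n / d : ℝ≥0) : ℝ) ^ 2 :=
  Real.sq_sqrt (by positivity)

lemma uniformSd_pos {d n : ℕ} [NeZero d] (hn : 0 < n) : 0 < uniformSd d n := by
  have hd : (0 : ℝ) < d := Nat.cast_pos.2 (NeZero.pos d)
  have hn' : (0 : ℝ) < n := Nat.cast_pos.2 hn
  rw [uniformSd_eq]
  positivity

theorem standardizedEllTwo_tendsto_gaussian (d n : ℕ → ℕ) [∀ k, NeZero (d k)] (hn : ∀ k, 0 < n k)
    (hd : Tendsto d atTop atTop)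
    (h : Tendsto (fun k => (n k : ℝ) / √(d k : ℝ)) atTop atTop) :
    TendstoInDistribution
      (fun k => standardizedEllTwo (n k) (PMF.uniformOfFintype (Fin (d k)))) atTop
      (id : ℝ → ℝ) (fun k => sampleLaw (n k) (PMF.uniformOfFintype (Fin (d k))))
      (gaussianReal 0 1) := by
  refine tendstoInDistribution_of_charFun
    (fun k => (measurable_standardizedEllTwo_uniform _).aemeasurable) aemeasurable_id fun t => ?_
  rw [Measure.map_id, charFun_gaussianReal]
  simp_rw [charFun_standardizedEllTwo_uniform]
  have hdR : Tendsto (fun k => (d k : ℝ)) atTop atTop := tendsto_natCast_atTop_atTop.comp hd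
  -- The approximants tend to `exp (-t²/2)` using only `d → ∞`; the growth of `n/√d` enters through
  -- the error bound.
  have hlim : Tendsto (fun k => ((1 - t ^ 2 / 2 / d k : ℝ) : ℂ) ^ d k) atTop
      (𝓝 (Complex.exp (t * (0 : ℝ) * Complex.I - (1 : ℝ≥0) * t ^ 2 / 2))) := by
    have h1 := (Complex.tendsto_one_add_div_pow_exp (-(t ^ 2 / 2 : ℂ))).comp hd
    convert! h1 using 2
    · simp only [Function.comp]
      push_cast
      ring_nf
    · congr 1
      push_cast
      ring
  have hs : Tendsto (fun k => uniformSd (d k) (n k)) atTop atTop := by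
    simp_rw [uniformSd_eq]
    exact h.const_mul_atTop (by positivity)
  have hbound : Tendsto (fun k => 134 * |t| ^ 3 *
      √((uniformSd (d k) (n k) ^ 2)⁻¹ + (2 * d k : ℝ)⁻¹)) atTop (𝓝 0) := by
    have h1 : Tendsto (fun k => (uniformSd (d k) (n k) ^ 2)⁻¹) atTop (𝓝 0) :=
      tendsto_inv_atTop_zero.comp ((tendsto_pow_atTop two_ne_zero).comp hs)
    have h2 : Tendsto (fun k => (2 * d k : ℝ)⁻¹) atTop (𝓝 0) :=
      tendsto_inv_atTop_zero.comp (hdR.const_mul_atTop two_pos)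
    simpa using ((h1.add h2).sqrt).const_mul (134 * |t| ^ 3)
  have hdiff : Tendsto (fun k => charFun ((realPoisson (n k / d k)).map
      (cellStat (n k / d k : ℝ≥0))) ((uniformSd (d k) (n k))⁻¹ * t) ^ d k -
      ((1 - t ^ 2 / 2 / d k : ℝ) : ℂ) ^ d k) atTop (𝓝 0) := by
    refine squeeze_zero_norm' ?_ hbound
    have hsmall : Tendsto (fun k => t ^ 2 / 2 / (d k : ℝ)) atTop (𝓝 0) := hdR.const_div_atTop _
    filter_upwards [hsmall.eventually_le_const two_pos] with k hk
    have hr : (0 : ℝ≥0) < n k / d k :=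
      div_pos (Nat.cast_pos.2 (hn k)) (Nat.cast_pos.2 (NeZero.pos (d k)))
    exact norm_charFun_cellStat_pow_sub_le _ hr (NeZero.pos (d k)) (uniformSd_pos (hn k))
      (uniformSd_sq _) hk
  simpa using hdiff.add hlim

theorem standardizedEllTwo_tendsto_dirac (d n : ℕ → ℕ) [∀ k, NeZero (d k)] (hn : ∀ k, 0 < n k)
    (h : Tendsto (fun k => (n k : ℝ) / √(d k : ℝ)) atTop (𝓝 0)) :
    TendstoInDistribution
      (fun k => standardizedEllTwo (n k) (PMF.uniformOfFintype (Fin (d k)))) atTop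
      (id : ℝ → ℝ) (fun k => sampleLaw (n k) (PMF.uniformOfFintype (Fin (d k))))
      (Measure.dirac 0) := by
  refine tendstoInDistribution_of_charFun
    (fun k => (measurable_standardizedEllTwo_uniform _).aemeasurable) aemeasurable_id fun t => ?_
  rw [Measure.map_id, charFun_dirac]
  simp_rw [charFun_standardizedEllTwo_uniform]
  have hs : Tendsto (fun k => 2 * |t| * uniformSd (d k) (n k)) atTop (𝓝 0) := by
    simp_rw [uniformSd_eq]
    simpa using (h.const_mul √2).const_mul (2 * |t|)
  have hdiff := squeeze_zero_norm (fun k => norm_charFun_cellStat_pow_sub_one_le (t := t)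
    (n k / d k : ℝ≥0) (uniformSd_pos (hn k)) (uniformSd_sq (d := d k) (n k))) hs
  simpa using hdiff.add_const 1

/-! ### Classical limit for a fixed number of cells. -/

lemma charFun_map_normalized_realPoisson (p : ℝ≥0) (n : ℕ) (t : ℝ) :
    charFun ((realPoisson (n * p)).map fun x => (√n)⁻¹ * (x - n * p)) t =
      Complex.exp (n * p * (Complex.exp (((√n)⁻¹ * t : ℝ) * Complex.I) - 1 -
        ((√n)⁻¹ * t : ℝ) * Complex.I)) := by
  rw [charFun_map_mul_comp (f := fun x : ℝ => x - n * p) (by fun_prop)]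
  simp_rw [sub_eq_add_neg]
  rw [charFun_map_add_const, charFun_map_cast_poissonMeasure, ← Complex.exp_add]
  congr 1
  simp
  ring

/-- The central limit theorem for the Poisson distribution. -/
lemma realPoisson_tendsto_gaussian (p : ℝ≥0) :
    TendstoInDistribution (fun (n : ℕ) (x : ℝ) => (√n)⁻¹ * (x - n * p)) atTop (id : ℝ → ℝ)
      (fun n : ℕ => realPoisson (n * p)) (gaussianReal 0 p) := by
  refine tendstoInDistribution_of_charFun (fun n => by fun_prop) aemeasurable_id fun t => ?_
  rw [Measure.map_id, charFun_gaussianReal]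
  simp_rw [charFun_map_normalized_realPoisson]
  refine (Complex.continuous_exp.tendsto _).comp ?_
  rw [tendsto_iff_norm_sub_tendsto_zero]
  have hsqrt : Tendsto (fun n : ℕ => (√n)⁻¹) atTop (𝓝 0) :=
    tendsto_inv_atTop_zero.comp (Real.tendsto_sqrt_atTop.comp tendsto_natCast_atTop_atTop)
  have hb : Tendsto (fun n : ℕ => 4 * p * |t| ^ 3 * (√n)⁻¹) atTop (𝓝 0) := by
    simpa using hsqrt.const_mul (4 * p * |t| ^ 3 : ℝ)
  refine squeeze_zero' (Eventually.of_forall fun _ => norm_nonneg _) ?_ hb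
  filter_upwards [eventually_gt_atTop 0] with n hn
  have hn' : (0 : ℝ) < n := Nat.cast_pos.2 hn
  have hs : 0 < √(n : ℝ) := Real.sqrt_pos.2 hn'
  have hs2 : √(n : ℝ) ^ 2 = n := Real.sq_sqrt hn'.le
  -- Since `n u² = t²`, the quadratic term of the exponent is exactly the Gaussian one, and the
  -- cubic remainder is `O(n |u|³) = O(n^{-1/2})`.
  set u : ℝ := (√n)⁻¹ * t with hu
  have hu2 : (n : ℝ) * u ^ 2 = t ^ 2 := by
    rw [hu, mul_pow, inv_pow, hs2]; field_simp
  have hu2' : (n : ℂ) * (u : ℂ) ^ 2 = (t : ℂ) ^ 2 := by exact_mod_cast hu2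
  have e : (n * p * (Complex.exp (u * Complex.I) - 1 - u * Complex.I) -
      (t * (0 : ℝ) * Complex.I - p * t ^ 2 / 2) : ℂ) =
      n * p * (Complex.exp (u * Complex.I) - (1 + u * Complex.I - u ^ 2 / 2)) := by
    rw [← hu2']
    push_cast
    ring
  rw [e, norm_mul, norm_mul, Complex.norm_natCast]
  have hp : ‖((p : ℝ) : ℂ)‖ = p := by simp
  calc (n : ℝ) * ‖((p : ℝ) : ℂ)‖ *
        ‖Complex.exp (u * Complex.I) - (1 + u * Complex.I - u ^ 2 / 2)‖
      ≤ n * p * (4 * |u| ^ 3) := by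
        rw [hp]
        exact mul_le_mul_of_nonneg_left (norm_exp_mul_I_sub_le u) (by positivity)
    _ = 4 * p * |t| ^ 3 * (√n)⁻¹ := by
        rw [hu, abs_mul, abs_of_pos (inv_pos.2 hs), mul_pow]
        have : (n : ℝ) * (√n)⁻¹ ^ 3 = (√n)⁻¹ := by
          rw [← hs2, Real.sqrt_sq hs.le]; field_simp
        linear_combination (4 * p * |t| ^ 3 : ℝ) * this

/-- Write `N(0, p)` as `√p` times a standard normal. Scaling upwards never divides by `p`, so empty
cells with `p = 0` are included. -/
lemma map_chiSqOne (p : ℝ≥0) (w : ℝ) :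
    chiSqOne.map (fun z => (p : ℝ) / w * (z - 1)) =
      (gaussianReal 0 p).map fun y => (y ^ 2 - p) / w := by
  have h : gaussianReal 0 p = (gaussianReal 0 1).map (√p * ·) := by
    rw [gaussianReal_map_const_mul]
    congr 1
    · simp
    · ext; simp
  rw [chiSqOne, h, Measure.map_map (by fun_prop) (by fun_prop),
    Measure.map_map (by fun_prop) (by fun_prop)]
  congr 1
  funext x
  have hp : √(p : ℝ) ^ 2 = p := Real.sq_sqrt p.2
  simp only [Function.comp, mul_pow, hp]
  ring

/-- The difference is `-(x - np)/(wn)`, that is, `v = (x - np)/√n` times `-1/(w√n)`. Then `|v| ≤ (v²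
+ 1)/2` and `E v² = p` give the bound. -/
lemma integral_abs_remainder_le (p : ℝ≥0) {w : ℝ} (hw : 0 < w) {n : ℕ} (hn : 0 < n) :
    Integrable (fun x : ℝ => ((x - n * p) ^ 2 - x) / w / n -
        (((√n)⁻¹ * (x - n * p)) ^ 2 - p) / w) (realPoisson (n * p)) ∧
    ∫ x, |((x - n * p) ^ 2 - x) / w / n - (((√n)⁻¹ * (x - n * p)) ^ 2 - p) / w|
      ∂(realPoisson (n * p)) ≤ (p + 1) / (2 * w) * (√n)⁻¹ := by
  have hn' : (0 : ℝ) < n := Nat.cast_pos.2 hn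
  have hs : 0 < √(n : ℝ) := Real.sqrt_pos.2 hn'
  have hs2 : √(n : ℝ) ^ 2 = n := Real.sq_sqrt hn'.le
  obtain ⟨h1, h2⟩ := realPoisson_sub_sq (n * p)
  have hc : ((n * p : ℝ≥0) : ℝ) = n * p := by push_cast; rfl
  rw [hc] at h1 h2
  have hint : Integrable (fun x : ℝ => (2 * w)⁻¹ * (√n)⁻¹ * ((n : ℝ)⁻¹ * (x - n * p) ^ 2 + 1))
      (realPoisson (n * p)) := ((h1.const_mul _).add (integrable_const _)).const_mul _
  have hle (x : ℝ) : |((x - n * p) ^ 2 - x) / w / n - (((√n)⁻¹ * (x - n * p)) ^ 2 - p) / w| ≤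
      (2 * w)⁻¹ * (√n)⁻¹ * ((n : ℝ)⁻¹ * (x - n * p) ^ 2 + 1) := by
    have e : ((x - n * p) ^ 2 - x) / w / n - (((√n)⁻¹ * (x - n * p)) ^ 2 - p) / w =
        -(w⁻¹ * (√n)⁻¹ * ((√n)⁻¹ * (x - n * p))) := by
      rw [mul_pow, inv_pow, hs2]
      have : (√(n : ℝ))⁻¹ * (√n)⁻¹ = (n : ℝ)⁻¹ := by rw [← mul_inv, ← pow_two, hs2]
      rw [show w⁻¹ * (√(n : ℝ))⁻¹ * ((√n)⁻¹ * (x - n * p)) =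
        w⁻¹ * ((√(n : ℝ))⁻¹ * (√n)⁻¹) * (x - n * p) by ring, this]
      field_simp
      ring
    have e2 : (n : ℝ)⁻¹ * (x - n * p) ^ 2 = ((√n)⁻¹ * (x - n * p)) ^ 2 := by
      rw [mul_pow, inv_pow, hs2]
    rw [e, e2, abs_neg, abs_mul, abs_of_pos (by positivity : 0 < w⁻¹ * (√(n : ℝ))⁻¹), mul_inv]
    generalize (√(n : ℝ))⁻¹ * (x - n * p) = v
    have hv : |v| ≤ 2⁻¹ * (v ^ 2 + 1) := by nlinarith [sq_nonneg (|v| - 1), sq_abs v]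
    calc w⁻¹ * (√(n : ℝ))⁻¹ * |v| ≤ w⁻¹ * (√(n : ℝ))⁻¹ * (2⁻¹ * (v ^ 2 + 1)) := by gcongr
      _ = _ := by ring
  refine ⟨hint.mono' (by fun_prop) (Eventually.of_forall hle), ?_⟩
  refine (integral_mono_of_nonneg (Eventually.of_forall fun _ => abs_nonneg _) hint
    (Eventually.of_forall hle)).trans_eq ?_
  rw [integral_const_mul, integral_add (h1.const_mul _) (integrable_const _), integral_const_mul,
    h2]
  simp
  field_simp

/-- Slutsky's argument on characteristic functions: continuous mapping applied to the Poisson CLT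
gives the limit, and the `L¹` remainder does not affect it. -/
lemma tendsto_charFun_weighted_cell (p : ℝ≥0) {w : ℝ} (hw : 0 < w) (t : ℝ) :
    Tendsto (fun n : ℕ => charFun ((realPoisson (n * p)).map
        fun x => ((x - n * p) ^ 2 - x) / w / n) t) atTop
      (𝓝 (charFun (chiSqOne.map fun z => (p : ℝ) / w * (z - 1)) t)) := by
  have h1 := tendsto_charFun_of_tendstoInDistribution
    ((realPoisson_tendsto_gaussian p).continuous_comp
      (g := fun y : ℝ => (y ^ 2 - p) / w) (by fun_prop)) t
  rw [map_chiSqOne]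
  have hsqrt : Tendsto (fun n : ℕ => (√n)⁻¹) atTop (𝓝 0) :=
    tendsto_inv_atTop_zero.comp (Real.tendsto_sqrt_atTop.comp tendsto_natCast_atTop_atTop)
  have hb : Tendsto (fun n : ℕ => |t| * ((p + 1) / (2 * w) * (√n)⁻¹)) atTop (𝓝 0) := by
    simpa using (hsqrt.const_mul ((p + 1) / (2 * w) : ℝ)).const_mul |t|
  have h2 : Tendsto (fun n : ℕ => charFun ((realPoisson (n * p)).map
        fun x => ((x - n * p) ^ 2 - x) / w / n) t -
      charFun ((realPoisson (n * p)).map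
        fun x => (((√n)⁻¹ * (x - n * p)) ^ 2 - p) / w) t) atTop (𝓝 0) := by
    refine squeeze_zero_norm' ?_ hb
    filter_upwards [eventually_gt_atTop 0] with n hn
    obtain ⟨hi, hle⟩ := integral_abs_remainder_le p hw hn
    exact (norm_charFun_map_sub_le (by fun_prop) (by fun_prop) hi t).trans
      (mul_le_mul_of_nonneg_left hle (abs_nonneg t))
  simpa [Function.comp_def] using h2.add h1

theorem weightedStat_tendsto {d : ℕ} (p₀ : PMF (Fin d)) (w : Fin d → ℝ) (hw : ∀ j, 0 < w j) :
    TendstoInDistribution (fun (n : ℕ) s => weightedStat n p₀ w s / n) atTop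
      (fun z : Fin d → ℝ => ∑ j, (p₀ j).toReal / w j * (z j - 1))
      (fun n => sampleLaw n p₀) (Measure.pi fun _ : Fin d => chiSqOne) := by
  have hstat (n : ℕ) : (fun s => weightedStat n p₀ w s / n) = fun s =>
      ∑ j, (fun (j : Fin d) (x : ℝ) => ((x - n * (p₀ j).toReal) ^ 2 - x) / w j / n) j
        (count j s) := by
    funext s
    rw [weightedStat, Finset.sum_div]
  refine tendstoInDistribution_of_charFun (fun n => ?_)
    (Finset.measurable_sum _ fun j _ => by fun_prop).aemeasurable fun t => ?_
  · rw [hstat]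
    exact (measurable_sum_comp_count
      (h := fun j x => ((x - n * (p₀ j).toReal) ^ 2 - x) / w j / n)
      (fun _ => by fun_prop)).aemeasurable
  · rw [charFun_map_sum_comp_pi (fun _ => chiSqOne)
      (h := fun j z => (p₀ j).toReal / w j * (z - 1)) (fun _ => by fun_prop)]
    simp_rw [hstat]
    have (n : ℕ) := charFun_map_sum_comp_count n p₀
      (h := fun j x => ((x - n * (p₀ j).toReal) ^ 2 - x) / w j / n) (fun _ => by fun_prop) t
    simp_rw [this]
    exact tendsto_finsetProd _ fun j _ => tendsto_charFun_weighted_cell (p₀ j).toNNReal (hw j) t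

end PoissonizedMultinomial

theorem mainTheorem9 :
    -- Classical asymptotics: the null `p₀` and the positive weights `w` are fixed, `n → ∞`;
    -- the limit is a weighted sum of independent centred `χ²₁` variables `Z₁, …, Z_d`.
    (∀ (d : ℕ) (p₀ : PMF (Fin d)) (w : Fin d → ℝ), (∀ j, 0 < w j) →
      TendstoInDistribution
        (fun (n : ℕ) s => PoissonizedMultinomial.weightedStat n p₀ w s / n) atTop
        (fun z : Fin d → ℝ => ∑ j, (p₀ j).toReal / w j * (z j - 1))
        (fun n => PoissonizedMultinomial.sampleLaw n p₀)
        (Measure.pi fun _ : Fin d => PoissonizedMultinomial.chiSqOne)) ∧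
    -- High-dimensional asymptotics: the null is uniform on `d` cells, `d → ∞`.
    (∀ (d n : ℕ → ℕ) [∀ k, NeZero (d k)], (∀ k, 0 < n k) → Tendsto d atTop atTop →
      -- the statistic has a finite and positive variance under the null,
      (∀ k,
        MemLp (PoissonizedMultinomial.ellTwoStat (n k) (PMF.uniformOfFintype (Fin (d k)))) 2
          (PoissonizedMultinomial.sampleLaw (n k) (PMF.uniformOfFintype (Fin (d k)))) ∧
        0 < variance
          (PoissonizedMultinomial.ellTwoStat (n k) (PMF.uniformOfFintype (Fin (d k))))
          (PoissonizedMultinomial.sampleLaw (n k) (PMF.uniformOfFintype (Fin (d k))))) ∧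
      -- the limit is `N(0, 1)` if `n / √d → ∞`,
      (Tendsto (fun k => (n k : ℝ) / √(d k : ℝ)) atTop atTop →
        TendstoInDistribution
          (fun k => PoissonizedMultinomial.standardizedEllTwo (n k)
            (PMF.uniformOfFintype (Fin (d k)))) atTop
          (id : ℝ → ℝ)
          (fun k => PoissonizedMultinomial.sampleLaw (n k) (PMF.uniformOfFintype (Fin (d k))))
          (gaussianReal 0 1)) ∧
      -- and the limit is `δ₀` if `n / √d → 0`.
      (Tendsto (fun k => (n k : ℝ) / √(d k : ℝ)) atTop (𝓝 0) →
        TendstoInDistribution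
          (fun k => PoissonizedMultinomial.standardizedEllTwo (n k)
            (PMF.uniformOfFintype (Fin (d k)))) atTop
          (id : ℝ → ℝ)
          (fun k => PoissonizedMultinomial.sampleLaw (n k) (PMF.uniformOfFintype (Fin (d k))))
          (Measure.dirac 0))) := by
  refine ⟨fun d p₀ w hw => PoissonizedMultinomial.weightedStat_tendsto p₀ w hw,
    fun d n _ hn hd => ⟨fun k => ⟨PoissonizedMultinomial.memLp_ellTwoStat _ _, ?_⟩,
      PoissonizedMultinomial.standardizedEllTwo_tendsto_gaussian d n hn hd,
      PoissonizedMultinomial.standardizedEllTwo_tendsto_dirac d n hn⟩⟩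
  rw [PoissonizedMultinomial.variance_ellTwoStat_uniform, ← PoissonizedMultinomial.uniformSd_sq]
  have := PoissonizedMultinomial.uniformSd_pos (d := d k) (hn k)
  positivity
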